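/- Let $p$ be a prime and let $G$ be a torsion-free abelian group of finite rank (that is, the maximal linearly independent subsets of $G$ over $\mathbb{Z}$ are finite). For an abelian group $A$ write $A^{*p}=\mathrm{Hom}(A,\mathbb{Z}_p)$ for the group of all additive maps $A\to\mathbb{Z}_p$, and let $G^{*p*p}=(G^{*p})^{*p}$; for $g\in G$ let $\hat g\in G^{*p*p}$ be the map $\hat g(\varphi)=\varphi(g)$. Give $G^{*p*p}$ the topology of pointwise convergence on $G^{*p}$ (with the usual topology on $\mathbb{Z}_p$). Let $D$ be the largest divisible subgroup of $G\otimes_{\mathbb{Z}}\mathbb{Z}_p$, and give $Q=(G\otimes_{\mathbb{Z}}\mathbb{Z}_p)/D$ the $p$-adic topology, in which the subgroups $p^nQ$ $(n\ge 0)$ form a basis of neighbourhoods of $0$. Then there is a group isomorphism $e:G^{*p*p}\to Q$, continuous and with continuous inverse, such that $$e(\hat g)=g\otimes 1+D\qquad\text{for all } g\in G .$$ -/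

import Mathlib

open scoped TensorProduct Topology

/-- The group `G^{*p} = Hom(G, ℤ_p)` of `p`-adic functionals on an abelian group `G`. -/
abbrev PadicDual (p : ℕ) [Fact p.Prime] (G : Type*) [AddCommGroup G] : Type _ :=
  G →+ ℤ_[p]

/-- The `p`-adic double dual `G^{*p*p} = Hom(Hom(G, ℤ_p), ℤ_p)`. All additive maps are allowed;
an additive map from a `ℤ_p`-module to `ℤ_p` is automatically `ℤ_p`-linear, and it is automatically
continuous for the `p`-adic topology on its domain. -/
abbrev PadicDoubleDual (p : ℕ) [Fact p.Prime] (G : Type*) [AddCommGroup G] : Type _ :=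
  PadicDual p (PadicDual p G)

/-- The natural homomorphism `g ↦ ĝ` from `G` to `G^{*p*p}`, where `ĝ(φ) = φ(g)`. -/
noncomputable def padicHat (p : ℕ) [Fact p.Prime] (G : Type*) [AddCommGroup G] :
    G →+ PadicDoubleDual p G :=
  AddMonoidHom.eval

/-- The topology of `G^{*p*p}` as a profinite group: pointwise convergence on `G^{*p}`, that is,
the subspace topology from the product of copies of `ℤ_p` indexed by `G^{*p}`. -/
@[reducible]
noncomputable def padicDoubleDualTopology (p : ℕ) [Fact p.Prime] (G : Type*) [AddCommGroup G] :
    TopologicalSpace (PadicDoubleDual p G) :=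
  TopologicalSpace.induced (fun (ψ : PadicDoubleDual p G) (φ : PadicDual p G) => ψ φ)
    inferInstance

/-- The `p`-adic topology on an abelian group `A`: the subgroups `p ^ n A` form a basis of
neighbourhoods of `0`. -/
@[reducible]
noncomputable def padicGroupTopology (p : ℕ) (A : Type*) [AddCommGroup A] : TopologicalSpace A :=
  (Ideal.span {(p : ℤ)}).adicModuleTopology A

/-- The divisible subgroup of an abelian group `A`: the largest divisible subgroup of `A`, which is
the join of all subgroups of `A` that are divisible as abelian groups. -/
def divisibleSubgroup (A : Type*) [AddCommGroup A] : AddSubgroup A :=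
  sSup {H : AddSubgroup A | ∀ n : ℕ, n ≠ 0 → ∀ x ∈ H, ∃ y ∈ H, n • y = x}

/-! Let M = ℤ_p ⊗ G and H = M / ⋂ pⁿM. Since M is torsion-free of finite rank, H is free of finite
rank over ℤ_p (`hausdorffification_finite`). Additive maps from ℤ_p-modules to ℤ_p are linear and,
ℤ_p being Hausdorff, kill ⋂ pⁿM; so G^{*p} is the dual of H, and reflexivity makes evaluation M →
G^{*p*p} surjective. Its kernel ⋂ pⁿM is the divisible part D
(`divisibleSubgroup_tensorProduct_padicInt`), which gives the isomorphism. The topologies agree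
because finitely many coordinates on H detect divisibility by pⁿ. -/

theorem Ideal.mem_span_singleton_pow_smul_top {R M : Type*} [CommRing R] [AddCommGroup M]
    [Module R M] (r : R) (n : ℕ) (x : M) :
    x ∈ (Ideal.span {r} ^ n • ⊤ : Submodule R M) ↔ ∃ y, r ^ n • y = x := by
  rw [Ideal.span_singleton_pow, Submodule.ideal_span_singleton_smul,
    Submodule.mem_smul_pointwise_iff_exists]
  simp

theorem isPrecomplete_pi_span_singleton {R ι : Type*} [CommRing R] (r : R)
    [IsPrecomplete (Ideal.span {r}) R] : IsPrecomplete (Ideal.span {r}) (ι → R) := by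
  refine ⟨fun f hf ↦ ?_⟩
  have h (i : ι) : ∃ L, ∀ n, f n i ≡ L [SMOD (Ideal.span {r} ^ n • ⊤ : Submodule R R)] := by
    refine IsPrecomplete.prec ‹_› fun {m n} hmn ↦ ?_
    have := hf hmn
    rw [SModEq.sub_mem, Ideal.mem_span_singleton_pow_smul_top] at this ⊢
    obtain ⟨y, hy⟩ := this
    exact ⟨y i, congrFun hy i⟩
  choose L hL using h
  refine ⟨L, fun n ↦ ?_⟩
  simp only [SModEq.sub_mem, Ideal.mem_span_singleton_pow_smul_top] at hL ⊢
  choose y hy using hL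
  exact ⟨fun i ↦ y i n, funext fun i ↦ hy i n⟩

/-! ### Modules over ℤ_p and their Hausdorff quotients -/

namespace PadicInt

variable {p : ℕ} [Fact p.Prime]

instance isAdicComplete_span_p : IsAdicComplete (Ideal.span {(p : ℤ_[p])}) ℤ_[p] := by
  rw [← maximalIdeal_eq_span_p]
  infer_instance

theorem eq_zero_of_forall_pow_dvd {x : ℤ_[p]} (h : ∀ n, (p : ℤ_[p]) ^ n ∣ x) : x = 0 := by
  refine IsHausdorff.haus (I := Ideal.span {(p : ℤ_[p])}) inferInstance x fun n ↦ ?_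
  rw [SModEq.zero, Ideal.mem_span_singleton_pow_smul_top]
  obtain ⟨c, rfl⟩ := h n
  exact ⟨c, rfl⟩

/-- An additive map between a `ℤ_p`-module and `ℤ_p` is `ℤ_p`-linear. -/
theorem addMonoidHom_map_smul {A : Type*} [AddCommGroup A] [Module ℤ_[p] A] (f : A →+ ℤ_[p])
    (a : ℤ_[p]) (x : A) : f (a • x) = a * f x := by
  rw [← sub_eq_zero]
  refine eq_zero_of_forall_pow_dvd fun n ↦ ?_
  -- Modulo pⁿ the scalar is a natural number, with which f commutes.
  obtain ⟨b, hb⟩ := Ideal.mem_span_singleton.mp (a.appr_spec n)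
  obtain ⟨k, rfl⟩ : ∃ k : ℕ, a = k + p ^ n * b := ⟨a.appr n, by rw [← hb]; ring⟩
  clear hb
  refine ⟨f (b • x) - b * f x, ?_⟩
  have h : ((k : ℤ_[p]) + p ^ n * b) • x = k • x + (p ^ n : ℕ) • b • x := by
    rw [add_smul, mul_smul, Nat.cast_smul_eq_nsmul, ← Nat.cast_smul_eq_nsmul ℤ_[p] (p ^ n)]
    push_cast; rfl
  rw [h, map_add, map_nsmul, map_nsmul, nsmul_eq_mul, nsmul_eq_mul]
  push_cast
  ring

/-- The `ℤ_p`-linear functional underlying an additive map from a `ℤ_p`-module to `ℤ_p`. -/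
def linearOfAddMonoidHom {A : Type*} [AddCommGroup A] [Module ℤ_[p] A] (f : A →+ ℤ_[p]) :
    A →ₗ[ℤ_[p]] ℤ_[p] where
  __ := f
  map_smul' := addMonoidHom_map_smul f

theorem exists_eq_unit_mul_p_pow {a : ℤ_[p]} (ha : a ≠ 0) :
    ∃ (u : ℤ_[p]ˣ) (k : ℕ), a = u * p ^ k :=
  ⟨_, _, unitCoeff_spec ha⟩

section Hausdorffification

variable (M : Type*) [AddCommGroup M] [Module ℤ_[p] M]

theorem hausdorffification_of_eq_zero_iff {M : Type*} [AddCommGroup M] [Module ℤ_[p] M] {x : M} :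
    Hausdorffification.of (Ideal.span {(p : ℤ_[p])}) M x = 0 ↔
      ∀ n : ℕ, ∃ y : M, (p : ℤ_[p]) ^ n • y = x := by
  refine (Submodule.Quotient.mk_eq_zero _).trans ?_
  simp [Submodule.mem_iInf, Ideal.mem_span_singleton_pow_smul_top]

/-- If a = u pᵏ and a x is divisible by p^(k+n), cancelling a in M shows that x is divisible by pⁿ.
-/
instance hausdorffification_isTorsionFree [Module.IsTorsionFree ℤ_[p] M] :
    Module.IsTorsionFree ℤ_[p] (Hausdorffification (Ideal.span {(p : ℤ_[p])}) M) := by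
  refine .of_smul_eq_zero fun a q h ↦ or_iff_not_imp_left.mpr fun ha ↦ ?_
  induction q using Hausdorffification.induction_on with | ih x
  rw [← map_smul, hausdorffification_of_eq_zero_iff] at h
  rw [hausdorffification_of_eq_zero_iff]
  intro n
  obtain ⟨u, k, hu⟩ := exists_eq_unit_mul_p_pow ha
  obtain ⟨y, hy⟩ := h (k + n)
  refine ⟨(↑u⁻¹ : ℤ_[p]) • y, smul_right_injective M ha ?_⟩
  dsimp only
  rw [← hy, smul_smul, smul_smul, hu]
  congr 1
  calc _ = ((u : ℤ_[p]) * ↑u⁻¹) * (p ^ k * p ^ n) := by ring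
    _ = _ := by rw [Units.mul_inv, one_mul, pow_add]

open IsLocalRing in
/-- The largest `p`-adically Hausdorff quotient of a torsion-free `ℤ_p`-module of finite rank is
finitely generated. -/
theorem hausdorffification_finite [Module.IsTorsionFree ℤ_[p] M]
    (hM : Module.rank ℤ_[p] M < Cardinal.aleph0) :
    Module.Finite ℤ_[p] (Hausdorffification (Ideal.span {(p : ℤ_[p])}) M) := by
  let I := Ideal.span {(p : ℤ_[p])}
  let k := ResidueField ℤ_[p]
  have : Module.Flat ℤ_[p] M := inferInstance
  let w := Module.Free.chooseBasis k (k ⊗[ℤ_[p]] M)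
  obtain ⟨v, hv⟩ := (TensorProduct.mk_surjective ℤ_[p] M k Ideal.Quotient.mk_surjective).comp_left w
  -- By flatness, lifts of a residue basis stay independent, so the rank bounds the residue
  -- dimension.
  have hli : LinearIndependent ℤ_[p] v :=
    Module.IsLocalRing.linearIndependent_of_flat v (by
      convert! w.linearIndependent)
  have : Finite (Module.Free.ChooseBasisIndex k (k ⊗[ℤ_[p]] M)) :=
    Cardinal.lt_aleph0_iff_finite.mp <| by
      have := hli.cardinal_lift_le_rank
      exact Cardinal.lift_lt_aleph0.mp (this.trans_lt (Cardinal.lift_lt_aleph0.mpr hM))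
  have := Fintype.ofFinite (Module.Free.ChooseBasisIndex k (k ⊗[ℤ_[p]] M))
  have : IsPrecomplete I (Module.Free.ChooseBasisIndex k (k ⊗[ℤ_[p]] M) → ℤ_[p]) :=
    isPrecomplete_pi_span_singleton _
  refine .of_surjective (Hausdorffification.of I M ∘ₗ Fintype.linearCombination ℤ_[p] v) ?_
  -- From a precomplete module to a Hausdorff one, surjectivity modulo I suffices.
  refine surjective_of_mkQ_comp_surjective (I := I) fun q ↦ ?_
  obtain ⟨q, rfl⟩ := Submodule.mkQ_surjective _ q
  induction q using Hausdorffification.induction_on with | ih x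
  obtain ⟨c, hc⟩ := (Ideal.Quotient.mk_surjective (I := maximalIdeal ℤ_[p])).comp_left
    (w.repr (1 ⊗ₜ x) : _ → k)
  refine ⟨c, ?_⟩
  have hmem : Fintype.linearCombination ℤ_[p] v c - x ∈ I • (⊤ : Submodule ℤ_[p] M) := by
    have hker := LinearMap.ker_tensorProductMk (R := ℤ_[p]) (Q := M) (I := maximalIdeal ℤ_[p])
    rw [show I = maximalIdeal ℤ_[p] from maximalIdeal_eq_span_p.symm, ← hker, LinearMap.mem_ker,
      map_sub, sub_eq_zero]
    rw [Fintype.linearCombination_apply, map_sum]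
    refine Eq.trans ?_ (w.sum_repr (1 ⊗ₜ x))
    refine Finset.sum_congr rfl fun i _ ↦ ?_
    rw [map_smul, ← congrFun hv i, ← congrFun hc i]
    rfl
  simp only [LinearMap.comp_apply]
  rw [← sub_eq_zero, ← map_sub, ← map_sub, Submodule.mkQ_apply, Submodule.Quotient.mk_eq_zero]
  have := Submodule.mem_map_of_mem (f := Hausdorffification.of I M) hmem
  rw [Submodule.map_smul''] at this
  exact Submodule.smul_mono le_rfl le_top this

end Hausdorffification

end PadicInt

/-! ### The p-adic and pointwise topologies -/

section PadicTopology

variable (p : ℕ) (A : Type*) [AddCommGroup A]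

theorem isTopologicalAddGroup_padicGroupTopology :
    @IsTopologicalAddGroup A (padicGroupTopology p A) _ :=
  AddGroupFilterBasis.isTopologicalAddGroup _

theorem hasBasis_nhds_zero_padicGroupTopology :
    (@nhds A (padicGroupTopology p A) 0).HasBasis (fun _ : ℕ ↦ True)
      fun n ↦ {x : A | ∃ y, p ^ n • y = x} := by
  have key (n : ℕ) : {x : A | ∃ y, p ^ n • y = x} =
      ((Ideal.span {(p : ℤ)} ^ n • ⊤ : Submodule ℤ A) : Set A) := by
    ext x
    rw [SetLike.mem_coe, Ideal.mem_span_singleton_pow_smul_top]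
    simp only [← Nat.cast_pow, Nat.cast_smul_eq_nsmul, Set.mem_ofPred_eq]
  simp only [key]
  let := (Ideal.span {(p : ℤ)}).adic_basis.topology
  refine ⟨fun U ↦ ?_⟩
  refine (((Ideal.span {(p : ℤ)}).ringFilterBasis.moduleFilterBasis
    ((Ideal.span {(p : ℤ)}).adic_module_basis A)).toAddGroupFilterBasis.nhds_zero_hasBasis
      |>.mem_iff).trans ?_
  constructor
  · rintro ⟨_, ⟨n, rfl⟩, hn⟩
    exact ⟨n, trivial, hn⟩
  · rintro ⟨n, -, hn⟩
    exact ⟨_, ⟨n, rfl⟩, hn⟩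

variable {A} {B : Type*} [AddCommGroup B]

theorem continuous_padicGroupTopology_of_forall [TopologicalSpace B] [IsTopologicalAddGroup B]
    (f : A →+ B) (h : ∀ U ∈ 𝓝 (0 : B), ∃ n : ℕ, ∀ y, p ^ n • f y ∈ U) :
    Continuous[padicGroupTopology p A, inferInstance] f := by
  let := padicGroupTopology p A
  have := isTopologicalAddGroup_padicGroupTopology p A
  refine continuous_of_continuousAt_zero f ?_
  rw [ContinuousAt, map_zero, (hasBasis_nhds_zero_padicGroupTopology p A).tendsto_left_iff]
  intro U hU
  obtain ⟨n, hn⟩ := h U hU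
  refine ⟨n, trivial, ?_⟩
  rintro _ ⟨y, rfl⟩
  rw [map_nsmul]
  exact hn y

variable [Fact p.Prime]

theorem PadicInt.setOf_pow_dvd_mem_nhds_zero (n : ℕ) : {x : ℤ_[p] | (p : ℤ_[p]) ^ n ∣ x} ∈ 𝓝 0 := by
  have hp : (0 : ℝ) < p := Nat.cast_pos.mpr (Fact.out : p.Prime).pos
  refine Filter.mem_of_superset (Metric.ball_mem_nhds 0 (zpow_pos hp (-n : ℤ))) fun x hx ↦ ?_
  rw [mem_ball_zero_iff] at hx
  exact Ideal.mem_span_singleton.mp ((PadicInt.norm_le_pow_iff_mem_span_pow x n).mp hx.le)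

theorem PadicInt.exists_pow_smul_mem_of_mem_nhds_zero {U : Set ℤ_[p]} (hU : U ∈ 𝓝 0) :
    ∃ n : ℕ, ∀ y : ℤ_[p], p ^ n • y ∈ U := by
  obtain ⟨ε, hε, hball⟩ := Metric.mem_nhds_iff.mp hU
  obtain ⟨n, hn⟩ := PadicInt.exists_pow_neg_lt p hε
  refine ⟨n, fun y ↦ hball ?_⟩
  rw [mem_ball_zero_iff]
  refine lt_of_le_of_lt ((PadicInt.norm_le_pow_iff_mem_span_pow _ n).mpr ?_) hn
  rw [nsmul_eq_mul, Nat.cast_pow]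
  exact Ideal.mul_mem_right _ _ (Ideal.mem_span_singleton_self _)

theorem continuous_padicGroupTopology_padicInt (f : A →+ ℤ_[p]) :
    Continuous[padicGroupTopology p A, inferInstance] f :=
  continuous_padicGroupTopology_of_forall p f fun _ hU ↦
    let ⟨n, hn⟩ := PadicInt.exists_pow_smul_mem_of_mem_nhds_zero p hU
    ⟨n, fun _ ↦ hn _⟩

theorem isTopologicalAddGroup_padicDoubleDualTopology :
    @IsTopologicalAddGroup (PadicDoubleDual p A) (padicDoubleDualTopology p A) _ :=
  topologicalAddGroup_induced (AddMonoidHom.coeFn (PadicDual p A) ℤ_[p])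

end PadicTopology

/-! ### Evaluation into the double dual -/

section DoubleDual

variable (p : ℕ) [Fact p.Prime] {G : Type*} [AddCommGroup G]

/-- The `ℤ_p`-linear extension of an additive map `G → ℤ_p` to `ℤ_p ⊗ G`. -/
noncomputable def padicExtend : (G →+ ℤ_[p]) ≃+ Module.Dual ℤ_[p] (ℤ_[p] ⊗[ℤ] G) :=
  (addMonoidHomLequivInt ℤ).toAddEquiv.trans
    (LinearMap.liftBaseChangeEquiv ℤ_[p]).toAddEquiv

/-- The evaluation map from `G ⊗ ℤ_p` to the `p`-adic double dual of `G`. -/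
noncomputable def padicEval : G ⊗[ℤ] ℤ_[p] →+ PadicDoubleDual p G :=
  AddMonoidHom.mk'
    (fun x ↦ AddMonoidHom.mk' (fun φ ↦ padicExtend p φ (TensorProduct.comm ℤ G ℤ_[p] x))
      fun φ ψ ↦ by rw [map_add, LinearMap.add_apply])
    fun x y ↦ by ext φ; simp

theorem padicEval_apply (x : G ⊗[ℤ] ℤ_[p]) (φ : G →+ ℤ_[p]) :
    padicEval p x φ = padicExtend p φ (TensorProduct.comm ℤ G ℤ_[p] x) := rfl

theorem padicEval_tmul_one (g : G) : padicEval p (g ⊗ₜ 1) = padicHat p G g := by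
  ext φ
  rw [padicEval_apply, TensorProduct.comm_tmul]
  exact LinearMap.liftBaseChange_one_tmul ℤ_[p] (addMonoidHomLequivInt ℤ φ) g

variable (G) in
/-- The largest `p`-adically Hausdorff quotient of `ℤ_p ⊗ G`. -/
abbrev PadicHausdorffQuotient : Type _ :=
  Hausdorffification (Ideal.span {(p : ℤ_[p])}) (ℤ_[p] ⊗[ℤ] G)

/-- The projection of `G ⊗ ℤ_p` to its largest `p`-adically Hausdorff quotient. -/
noncomputable def toPadicHausdorffQuotient : G ⊗[ℤ] ℤ_[p] →+ PadicHausdorffQuotient p G :=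
  (Hausdorffification.of (Ideal.span {(p : ℤ_[p])}) (ℤ_[p] ⊗[ℤ] G)).toAddMonoidHom.comp
    (TensorProduct.comm ℤ G ℤ_[p]).toLinearMap.toAddMonoidHom

theorem toPadicHausdorffQuotient_surjective :
    Function.Surjective (toPadicHausdorffQuotient p (G := G)) :=
  (Submodule.mkQ_surjective _).comp (TensorProduct.comm ℤ G ℤ_[p]).surjective

/-- The additive maps `G → ℤ_p` are the functionals on the Hausdorff quotient of `ℤ_p ⊗ G`. -/
noncomputable def dualHausdorffQuotientToPadicDual :
    Module.Dual ℤ_[p] (PadicHausdorffQuotient p G) →+ PadicDual p G :=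
  (padicExtend p).symm.toAddMonoidHom.comp (LinearMap.lcomp ℤ_[p] ℤ_[p]
    (Hausdorffification.of (Ideal.span {(p : ℤ_[p])}) (ℤ_[p] ⊗[ℤ] G))).toAddMonoidHom

theorem padicEval_dualHausdorffQuotientToPadicDual (x : G ⊗[ℤ] ℤ_[p])
    (f : Module.Dual ℤ_[p] (PadicHausdorffQuotient p G)) :
    padicEval p x (dualHausdorffQuotientToPadicDual p f) = f (toPadicHausdorffQuotient p x) := by
  rw [padicEval_apply]
  simp only [dualHausdorffQuotientToPadicDual, AddMonoidHom.comp_apply]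
  erw [AddEquiv.apply_symm_apply]
  rfl

theorem dualHausdorffQuotientToPadicDual_surjective :
    Function.Surjective (dualHausdorffQuotientToPadicDual p (G := G)) := fun φ ↦
  ⟨Hausdorffification.lift _ (padicExtend p φ), (padicExtend p).symm_apply_apply φ⟩

theorem padicEval_eq_iff (x : G ⊗[ℤ] ℤ_[p]) (ψ : PadicDoubleDual p G) :
    padicEval p x = ψ ↔ ∀ f : Module.Dual ℤ_[p] (PadicHausdorffQuotient p G),
      f (toPadicHausdorffQuotient p x) = ψ (dualHausdorffQuotientToPadicDual p f) := by
  simp only [← padicEval_dualHausdorffQuotientToPadicDual, DFunLike.ext_iff]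
  exact (dualHausdorffQuotientToPadicDual_surjective p).forall

theorem toPadicHausdorffQuotient_eq_zero_iff (x : G ⊗[ℤ] ℤ_[p]) :
    toPadicHausdorffQuotient p x = 0 ↔ ∀ n : ℕ, ∃ y, p ^ n • y = x := by
  refine PadicInt.hausdorffification_of_eq_zero_iff.trans (forall_congr' fun n ↦ ?_)
  rw [(TensorProduct.comm ℤ G ℤ_[p]).surjective.exists]
  refine exists_congr fun y ↦ ?_
  rw [← Nat.cast_pow, Nat.cast_smul_eq_nsmul]
  exact (by rw [← map_nsmul]; exact (TensorProduct.comm ℤ G ℤ_[p]).injective.eq_iff)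

variable [IsAddTorsionFree G]

theorem finite_padicHausdorffQuotient (hG : Module.rank ℤ G < Cardinal.aleph0) :
    Module.Finite ℤ_[p] (PadicHausdorffQuotient p G) := by
  refine PadicInt.hausdorffification_finite _ ?_
  have := (TensorProduct.isBaseChange ℤ G ℤ_[p]).lift_rank_eq
  rw [← Cardinal.lift_lt_aleph0.{_, u_1}, this]
  exact Cardinal.lift_lt_aleph0.mpr hG

/-- No nonzero element of ℤ_p is divisible by every pⁿ, so evaluation kills D. Conversely,
functionals separate points of H, so kernel elements are divisible by all pᵏ; the roots stay in the
kernel because ℤ_p is torsion-free. -/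
theorem divisibleSubgroup_tensorProduct_padicInt (hG : Module.rank ℤ G < Cardinal.aleph0) :
    divisibleSubgroup (G ⊗[ℤ] ℤ_[p]) = (padicEval p (G := G)).ker := by
  have := finite_padicHausdorffQuotient p hG
  have hp : p ≠ 0 := (Fact.out : p.Prime).ne_zero
  refine le_antisymm (sSup_le fun H hH x hx ↦ ?_) (le_sSup fun n hn x hx ↦ ?_)
  · ext φ
    refine PadicInt.eq_zero_of_forall_pow_dvd fun n ↦ ?_
    obtain ⟨y, -, rfl⟩ := hH (p ^ n) (pow_ne_zero n hp) x hx
    rw [map_nsmul, AddMonoidHom.nsmul_apply, nsmul_eq_mul, Nat.cast_pow]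
    exact dvd_mul_right _ _
  · have hx' : toPadicHausdorffQuotient p x = 0 :=
      (Module.forall_dual_apply_eq_zero_iff ℤ_[p] _).mp fun f ↦ by
        simpa using (padicEval_eq_iff p x 0).mp hx f
    obtain ⟨u, k, hu⟩ := PadicInt.exists_eq_unit_mul_p_pow (p := p) (Nat.cast_ne_zero.mpr hn)
    obtain ⟨y, hy⟩ := (toPadicHausdorffQuotient_eq_zero_iff p x).mp hx' k
    -- Since n = u pᵏ, acting by u⁻¹ on the ℤ_p factor turns a pᵏ-th root into an n-th root.
    let m : G ⊗[ℤ] ℤ_[p] →+ G ⊗[ℤ] ℤ_[p] :=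
      (LinearMap.lTensor G (AddMonoidHom.mulLeft (↑u⁻¹ : ℤ_[p])).toIntLinearMap).toAddMonoidHom
    have hm (z : G ⊗[ℤ] ℤ_[p]) : n • m z = p ^ k • z := by
      induction z with
      | zero => simp
      | add a b ha hb => rw [map_add, smul_add, smul_add, ha, hb]
      | tmul g a =>
        change n • g ⊗ₜ[ℤ] ((↑u⁻¹ : ℤ_[p]) * a) = _
        rw [← TensorProduct.tmul_smul, ← TensorProduct.tmul_smul]
        congr 1
        rw [nsmul_eq_mul, nsmul_eq_mul, hu, Nat.cast_pow]
        calc _ = ((u : ℤ_[p]) * ↑u⁻¹) * (p ^ k * a) := by ring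
          _ = _ := by rw [Units.mul_inv, one_mul]
    refine ⟨m y, ?_, (hm y).trans hy⟩
    rw [AddMonoidHom.mem_ker] at hx ⊢
    ext φ
    have h0 := DFunLike.congr_fun hx φ
    rw [← (hm y).trans hy, map_nsmul, AddMonoidHom.nsmul_apply] at h0
    exact (smul_eq_zero.mp h0).resolve_left hn

theorem padicEval_surjective (hG : Module.rank ℤ G < Cardinal.aleph0) :
    Function.Surjective (padicEval p (G := G)) := by
  intro ψ
  have := finite_padicHausdorffQuotient p hG
  let θ := PadicInt.linearOfAddMonoidHom (ψ.comp (dualHausdorffQuotientToPadicDual p))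
  obtain ⟨q, hq⟩ := (Module.evalEquiv ℤ_[p] (PadicHausdorffQuotient p G)).surjective θ
  obtain ⟨x, rfl⟩ := toPadicHausdorffQuotient_surjective p q
  exact ⟨x, (padicEval_eq_iff p x ψ).mpr fun f ↦ DFunLike.congr_fun hq f⟩

/-- The coordinate functionals of a basis of H serve for every n at once; this makes the pointwise
topology at least as fine as the p-adic one. -/
theorem exists_finset_forall_pow_dvd_imp (hG : Module.rank ℤ G < Cardinal.aleph0) :
    ∃ s : Finset (PadicDual p G), ∀ (n : ℕ) (ψ : PadicDoubleDual p G),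
      (∀ φ ∈ s, (p : ℤ_[p]) ^ n ∣ ψ φ) → ∃ y, padicEval p (p ^ n • y) = ψ := by
  classical
  have := finite_padicHausdorffQuotient p hG
  let b := Module.Free.chooseBasis ℤ_[p] (PadicHausdorffQuotient p G)
  refine ⟨Finset.univ.image fun i ↦ dualHausdorffQuotientToPadicDual p (b.coord i),
    fun n ψ h ↦ ?_⟩
  obtain ⟨x, rfl⟩ := padicEval_surjective p hG ψ
  simp only [Finset.forall_mem_image, Finset.mem_univ, true_imp_iff,
    padicEval_dualHausdorffQuotientToPadicDual] at h
  choose c hc using fun i ↦ h (x := i)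
  obtain ⟨y, hy⟩ := toPadicHausdorffQuotient_surjective p (∑ i, c i • b i)
  refine ⟨y, (padicEval_eq_iff p _ _).mpr fun f ↦ ?_⟩
  rw [padicEval_dualHausdorffQuotientToPadicDual]
  congr 1
  rw [map_nsmul, hy, ← b.sum_repr (toPadicHausdorffQuotient p x), Finset.smul_sum]
  refine Finset.sum_congr rfl fun i _ ↦ ?_
  rw [← b.coord_apply, hc, mul_smul, ← Nat.cast_pow, Nat.cast_smul_eq_nsmul]

end DoubleDual

theorem theorem3p1 (p : ℕ) [Fact p.Prime] (G : Type*) [AddCommGroup G] [IsAddTorsionFree G]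
    (hG : Module.rank ℤ G < Cardinal.aleph0) :
    ∃ e : PadicDoubleDual p G ≃+ (G ⊗[ℤ] ℤ_[p]) ⧸ divisibleSubgroup (G ⊗[ℤ] ℤ_[p]),
      Continuous[padicDoubleDualTopology p G,
        padicGroupTopology p ((G ⊗[ℤ] ℤ_[p]) ⧸ divisibleSubgroup (G ⊗[ℤ] ℤ_[p]))] e ∧
      Continuous[padicGroupTopology p ((G ⊗[ℤ] ℤ_[p]) ⧸ divisibleSubgroup (G ⊗[ℤ] ℤ_[p])),
        padicDoubleDualTopology p G] e.symm ∧
      ∀ g : G, e (padicHat p G g) =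
        QuotientAddGroup.mk' (divisibleSubgroup (G ⊗[ℤ] ℤ_[p])) (g ⊗ₜ[ℤ] (1 : ℤ_[p])) := by
  let e := ((QuotientAddGroup.quotientAddEquivOfEq
    (divisibleSubgroup_tensorProduct_padicInt p hG)).trans
    (QuotientAddGroup.quotientKerEquivOfSurjective _ (padicEval_surjective p hG))).symm
  have he (x : G ⊗[ℤ] ℤ_[p]) : e (padicEval p x) = QuotientAddGroup.mk' _ x :=
    (AddEquiv.eq_symm_apply e).mp rfl
  refine ⟨e, ?_, ?_, fun g ↦ by rw [← padicEval_tmul_one, he]⟩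
  · let := padicDoubleDualTopology p G
    let := padicGroupTopology p ((G ⊗[ℤ] ℤ_[p]) ⧸ divisibleSubgroup (G ⊗[ℤ] ℤ_[p]))
    have := isTopologicalAddGroup_padicDoubleDualTopology p (A := G)
    have := isTopologicalAddGroup_padicGroupTopology p
      ((G ⊗[ℤ] ℤ_[p]) ⧸ divisibleSubgroup (G ⊗[ℤ] ℤ_[p]))
    refine continuous_of_continuousAt_zero e ?_
    rw [ContinuousAt, map_zero, (hasBasis_nhds_zero_padicGroupTopology p _).tendsto_right_iff]
    intro n _
    obtain ⟨s, hs⟩ := exists_finset_forall_pow_dvd_imp p hG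
    have hφ (φ : PadicDual p G) : ∀ᶠ ψ : PadicDoubleDual p G in 𝓝 0, (p : ℤ_[p]) ^ n ∣ ψ φ := by
      have hc : Continuous fun ψ : PadicDoubleDual p G ↦ ψ φ :=
        (continuous_apply φ).comp continuous_induced_dom
      exact hc.tendsto' 0 0 rfl (PadicInt.setOf_pow_dvd_mem_nhds_zero p n)
    filter_upwards [(Filter.eventually_all_finset s).mpr fun φ _ ↦ hφ φ] with ψ hψ
    obtain ⟨y, rfl⟩ := hs n ψ hψ
    exact ⟨e (padicEval p y), by rw [map_nsmul, map_nsmul]⟩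
  · let := padicGroupTopology p ((G ⊗[ℤ] ℤ_[p]) ⧸ divisibleSubgroup (G ⊗[ℤ] ℤ_[p]))
    refine continuous_induced_rng.mpr (continuous_pi fun φ ↦ ?_)
    -- Each coordinate of the inverse is an additive map to ℤ_p, hence p-adically continuous.
    exact continuous_padicGroupTopology_padicInt p
      ((AddMonoidHom.eval φ).comp e.symm.toAddMonoidHom)
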